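/- Notation. $\|\cdot\|_2$ is the Euclidean norm of vectors and the spectral norm of matrices, $\|(A,\mathbf b)\|:=\sqrt{\|A\|_2^2+\|\mathbf b\|_2^2}$, $A^\dagger$ is the Moore–Penrose inverse of $A$, and $\mathrm{sol}(A,\mathbf b)=\{\mathbf u\in\mathbb C^n \mid A\mathbf u=\mathbf b\}$. For $G\in\mathbb C^{m\times n}$ with singular value decomposition $G=\sum_j\sigma_j\mathbf u_j\mathbf v_j^{\mathsf H}$ and $\theta>0$ that is not a singular value of $G$, the $\theta$-projection is $G_\theta=\sum_{\sigma_j>\theta}\sigma_j\mathbf u_j\mathbf v_j^{\mathsf H}$, and for $\mathbf d\in\mathbb C^m$ the vector $\mathbf d_\theta=G_\theta G_\theta^\dagger\mathbf d$ is the orthogonal projection of $\mathbf d$ onto the range of $G_\theta$. The affine Grassmannian $\mathcal A_k(\mathbb C^n)$ is the set of $k$-dimensional affine subspaces of $\mathbb C^n$ with the distance $$\mathrm{dist}(\mathbf u_1+\mathcal V_1,\mathbf u_2+\mathcal V_2)=\max\{\|\hat{\mathbf u}_1-\hat{\mathbf u}_2\|_2,\ \|P_{\mathcal V_1}-P_{\mathcal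 V_2}\|_2\},$$ where $\hat{\mathbf u}_j$ is the point of minimal norm of $\mathbf u_j+\mathcal V_j$ and $P_{\mathcal V}$ is the orthogonal projection onto $\mathcal V$. Corollary. Let $A\in\mathbb C^{m\times n}$, $A\neq O$, and $\mathbf b\in\mathbb C^m$ such that the underlying system $A\mathbf x=\mathbf b$ is consistent. Then there is a constant $C$, depending only on $(A,\mathbf b)$, such that the following holds for all empirical data $(\tilde A,\tilde{\mathbf b})\in\mathbb C^{m\times n}\times\mathbb C^m$ and every $\beta\in\mathbb R$ with $$\|A-\tilde A\|_2<\tfrac12\|A^\dagger\|_2^{-1}\quad\text{and}\quad \|A-\tilde A\|_2<\beta<\|A^\dagger\|_2^{-1}-\|A-\tilde A\|_2 .$$ Put $\theta=\beta$. Then $\theta$ is not a singular value of $\tilde A$, and $\mathrm{sol}(\tilde A_\theta,\tilde{\mathbf b}_\theta)$ solves the numerical linear system problem: it lies in the same affine Grassmannian $\mathcal A_{n-\mathrm{rank}(A)}(\mathbb C^n)$ as $\mathrm{sol}(A,\mathbf b)$, and the backward and the forward error are of the order of the data error, $$\|(\tilde A,\tilde{\mathbf b})-(\tilde A_\theta,\tilde{\mathbf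 b}_\theta)\|\le C\,\|(\tilde A,\tilde{\mathbf b})-(A,\mathbf b)\|,\qquad \mathrm{dist}\big(\mathrm{sol}(\tilde A_\theta,\tilde{\mathbf b}_\theta),\mathrm{sol}(A,\mathbf b)\big)\le C\,\|(\tilde A,\tilde{\mathbf b})-(A,\mathbf b)\|.$$ Furthermore, $$\mathrm{dist}\big(\mathrm{sol}(\tilde A_\theta,\tilde{\mathbf b}_\theta),\mathrm{sol}(A,\mathbf b)\big)\le \|A\|_2\|A^\dagger\|_2\cdot\frac{\sqrt{4\|A^\dagger\mathbf b\|_2^2+1}}{\|A\|_2-\|A\|_2\|A^\dagger\|_2\|A-\tilde A\|_2}\,\|(\tilde A,\tilde{\mathbf b})-(A,\mathbf b)\|.$$ -/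

import Mathlib

open scoped Matrix Matrix.Norms.L2Operator

-- From here on `‖A‖` is the spectral norm of a matrix `A`, that is, its operator norm with respect
-- to the Euclidean norms.

namespace NumLinSys

/-- The space of `n`-dimensional complex column vectors with the Euclidean norm. -/
abbrev Vec (n : ℕ) : Type := EuclideanSpace ℂ (Fin n)

/-- The space of complex `m × n` matrices. -/
abbrev Mat (m n : ℕ) : Type := Matrix (Fin m) (Fin n) ℂ

/-- The linear map `x ↦ A x` between the Euclidean spaces. -/
noncomputable abbrev lin {m n : ℕ} (A : Mat m n) : Vec n →ₗ[ℂ] Vec m := Matrix.toEuclideanLin A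

/-- The four Moore-Penrose conditions for `X` to be the Moore-Penrose inverse of `A`. -/
structure IsMoorePenrose {m n : ℕ} (A : Mat m n) (X : Mat n m) : Prop where
  mul_mul_left : A * X * A = A
  mul_mul_right : X * A * X = X
  hermitian_left : (A * X)ᴴ = A * X
  hermitian_right : (X * A)ᴴ = X * A

theorem IsMoorePenrose.unique {m n : ℕ} {A : Mat m n} {X Y : Mat n m}
    (hX : IsMoorePenrose A X) (hY : IsMoorePenrose A Y) : X = Y := by
  have h1 : A * X = A * Y := by
    calc A * X = (A * X)ᴴ := hX.hermitian_left.symm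
      _ = (A * Y * A * X)ᴴ := by rw [hY.mul_mul_left]
      _ = (A * X)ᴴ * (A * Y)ᴴ := by rw [← Matrix.conjTranspose_mul]; simp only [Matrix.mul_assoc]
      _ = A * X * (A * Y) := by rw [hX.hermitian_left, hY.hermitian_left]
      _ = A * X * A * Y := by simp only [Matrix.mul_assoc]
      _ = A * Y := by rw [hX.mul_mul_left]
  have h2 : X * A = Y * A := by
    calc X * A = (X * A)ᴴ := hX.hermitian_right.symm
      _ = (X * (A * Y * A))ᴴ := by rw [hY.mul_mul_left]
      _ = (Y * A)ᴴ * (X * A)ᴴ := by rw [← Matrix.conjTranspose_mul]; simp only [Matrix.mul_assoc]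
      _ = Y * A * (X * A) := by rw [hX.hermitian_right, hY.hermitian_right]
      _ = Y * (A * X * A) := by simp only [Matrix.mul_assoc]
      _ = Y * A := by rw [hX.mul_mul_left]
  calc X = X * A * X := hX.mul_mul_right.symm
    _ = Y * (A * X) := by rw [h2, Matrix.mul_assoc]
    _ = Y := by rw [h1, ← Matrix.mul_assoc, hY.mul_mul_right]

open scoped ComplexOrder in
theorem exists_isMoorePenrose {m n : ℕ} (A : Mat m n) : ∃ X : Mat n m, IsMoorePenrose A X := by
  have hH : (Aᴴ * A).IsHermitian := Matrix.isHermitian_conjTranspose_mul_self A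
  let U : Mat n n := hH.eigenvectorUnitary
  let e : Fin n → ℂ := fun i => (hH.eigenvalues i : ℂ)
  let D : Mat n n := Matrix.diagonal e
  let P : Mat n n := Matrix.diagonal (fun i => (e i)⁻¹)
  have hU : Uᴴ * U = 1 := by
    have := (Matrix.mem_unitaryGroup_iff').1 hH.eigenvectorUnitary.2
    simpa [Matrix.star_eq_conjTranspose] using this
  have hS : Aᴴ * A = U * D * Uᴴ := by
    have := hH.spectral_theorem
    simpa [Unitary.conjStarAlgAut_apply, Matrix.star_eq_conjTranspose, D, e, U,
      Function.comp_def] using this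
  have hPH : Pᴴ = P := by
    simp [P, e, Matrix.diagonal_conjTranspose, Pi.star_def]
  have hPD : (P * D)ᴴ = P * D := by
    simp [P, D, e, Matrix.diagonal_conjTranspose, Pi.star_def]
  have hDPD : D * (P * D) = D := by
    simp only [P, D, Matrix.diagonal_mul_diagonal]
    congr 1; ext i; by_cases h : e i = 0 <;> simp [h]
  have hPDP : P * D * P = P := by
    simp only [P, D, Matrix.diagonal_mul_diagonal]
    congr 1; ext i; by_cases h : e i = 0 <;> simp [h]
  let X : Mat n m := U * P * Uᴴ * Aᴴ
  have hXA : X * A = U * (P * D) * Uᴴ := by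
    calc X * A = U * P * Uᴴ * (Aᴴ * A) := by simp only [X, Matrix.mul_assoc]
      _ = U * P * (Uᴴ * U) * D * Uᴴ := by rw [hS]; simp only [Matrix.mul_assoc]
      _ = U * (P * D) * Uᴴ := by rw [hU, Matrix.mul_one]; simp only [Matrix.mul_assoc]
  have hXAH : (X * A)ᴴ = X * A := by
    rw [hXA, Matrix.conjTranspose_mul, Matrix.conjTranspose_mul, hPD,
      Matrix.conjTranspose_conjTranspose]
    simp only [Matrix.mul_assoc]
  have hG : Aᴴ * A * (X * A) = Aᴴ * A := by
    calc Aᴴ * A * (X * A) = U * D * (Uᴴ * U) * (P * D) * Uᴴ := by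
          rw [hXA, hS]; simp only [Matrix.mul_assoc]
      _ = U * (D * (P * D)) * Uᴴ := by rw [hU, Matrix.mul_one]; simp only [Matrix.mul_assoc]
      _ = Aᴴ * A := by rw [hDPD, hS]
  refine ⟨X, ?_, ?_, ?_, hXAH⟩
  · have hz : (A * (X * A) - A)ᴴ * (A * (X * A) - A) = 0 := by
      rw [Matrix.conjTranspose_sub, Matrix.conjTranspose_mul, hXAH]
      have h0 : Aᴴ * (A * (X * A) - A) = 0 := by
        rw [Matrix.mul_sub, ← Matrix.mul_assoc, hG, sub_self]
      rw [Matrix.sub_mul, Matrix.mul_assoc, h0, Matrix.mul_zero, sub_self]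
    have := Matrix.conjTranspose_mul_self_eq_zero.1 hz
    rw [Matrix.mul_assoc]; exact sub_eq_zero.1 this
  · calc X * A * X = U * (P * D) * (Uᴴ * U) * P * Uᴴ * Aᴴ := by
          rw [hXA]; simp only [X, Matrix.mul_assoc]
      _ = U * (P * D * P) * Uᴴ * Aᴴ := by rw [hU, Matrix.mul_one]; simp only [Matrix.mul_assoc]
      _ = X := by rw [hPDP]
  · simp only [X, Matrix.conjTranspose_mul, Matrix.conjTranspose_conjTranspose, hPH,
      Matrix.mul_assoc]

/-- The Moore-Penrose inverse of `A`. -/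
noncomputable def pinv {m n : ℕ} (A : Mat m n) : Mat n m := (exists_isMoorePenrose A).choose

theorem pinv_spec {m n : ℕ} (A : Mat m n) : IsMoorePenrose A (pinv A) :=
  (exists_isMoorePenrose A).choose_spec

/-- The singular values `σ₀ ≥ σ₁ ≥ …` of `A` in decreasing order, followed by zeros. -/
noncomputable def sv {m n : ℕ} (A : Mat m n) (j : ℕ) : ℝ := (lin A).singularValues j

/-- An orthonormal basis of right singular vectors of `A`, in the order of `sv A`. -/
noncomputable def rightVec {m n : ℕ} (A : Mat m n) : OrthonormalBasis (Fin n) ℂ (Vec n) :=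
  (lin A).isSymmetric_adjoint_comp_self.eigenvectorBasis finrank_euclideanSpace_fin

/-- The left singular vector of `A` that belongs to `rightVec A j`, if `sv A j` is positive. -/
noncomputable def leftVec {m n : ℕ} (A : Mat m n) (j : Fin n) : Vec m :=
  ((sv A j)⁻¹ : ℂ) • lin A (rightVec A j)

theorem adjoint_lin_rightVec {m n : ℕ} (A : Mat m n) (j : Fin n) :
    (lin A).adjoint (lin A (rightVec A j)) = ((sv A j) ^ 2 : ℂ) • rightVec A j := by
  have h := (lin A).isSymmetric_adjoint_comp_self.apply_eigenvectorBasis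
    finrank_euclideanSpace_fin j
  rw [← (lin A).sq_singularValues_fin] at h
  rw [LinearMap.comp_apply] at h
  simpa [sv, rightVec] using h

theorem lin_rightVec {m n : ℕ} (A : Mat m n) (j : Fin n) :
    lin A (rightVec A j) = (sv A j : ℂ) • leftVec A j := by
  by_cases h : sv A j = 0
  · have h1 := adjoint_lin_rightVec A j
    have h2 : inner ℂ (lin A (rightVec A j)) (lin A (rightVec A j)) = 0 := by
      rw [← LinearMap.adjoint_inner_right, h1, h]; simp
    rw [inner_self_eq_zero.1 h2, h]; simp
  · rw [leftVec, smul_smul, mul_inv_cancel₀ (by exact_mod_cast h), one_smul]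

theorem orthonormal_leftVec {m n : ℕ} (A : Mat m n) :
    Orthonormal ℂ (fun j : {j : Fin n // 0 < sv A j} => leftVec A j) := by
  rw [orthonormal_iff_ite]
  intro i j
  have hi : (sv A i : ℂ) ≠ 0 := by exact_mod_cast i.2.ne'
  have hj : (sv A j : ℂ) ≠ 0 := by exact_mod_cast j.2.ne'
  have h := orthonormal_iff_ite.1 (rightVec A).orthonormal i.1 j.1
  rw [leftVec, leftVec, inner_smul_left, inner_smul_right, ← LinearMap.adjoint_inner_right,
    adjoint_lin_rightVec, inner_smul_right, h]
  by_cases hij : i = j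
  · subst hij; simp; field_simp
  · simp [hij, Subtype.ext_iff.not.1 hij]

/-- The `θ`-projection `A_θ` of `A`: the sum of `σ_j u_j v_jᴴ` over the singular values `σ_j > θ`. -/
noncomputable def thetaProj {m n : ℕ} (θ : ℝ) (A : Mat m n) : Mat m n :=
  ∑ j ∈ Finset.univ.filter (fun j : Fin n => θ < sv A j),
    (sv A j : ℂ) • Matrix.vecMulVec (WithLp.ofLp (leftVec A j)) (star (WithLp.ofLp (rightVec A j)))

/-- The vector `d_θ`: the orthogonal projection of `d` onto the range of the `θ`-projection of `G`. -/
noncomputable def vecProj {m n : ℕ} (θ : ℝ) (G : Mat m n) (d : Vec m) : Vec m :=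
  (LinearMap.range (lin (thetaProj θ G))).starProjection d

/-- The solution set of `A x = b`, an affine subspace that may be empty. -/
noncomputable def sol {m n : ℕ} (A : Mat m n) (b : Vec m) : AffineSubspace ℂ (Vec n) where
  carrier := {u | lin A u = b}
  smul_vsub_vadd_mem' := by
    intro c p₁ p₂ p₃ h₁ h₂ h₃
    simp only [Set.mem_ofPred_eq] at h₁ h₂ h₃ ⊢
    simp [h₁, h₂, h₃]

/-- The affine Grassmannian of the (nonempty) `k`-dimensional affine subspaces of `ℂⁿ`. -/
def affineGrassmannian (k n : ℕ) : Set (AffineSubspace ℂ (Vec n)) :=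
  {s | (s : Set (Vec n)).Nonempty ∧ Module.finrank ℂ s.direction = k}

/-- The distance of two subspaces: the norm of the difference of the orthogonal projections. -/
noncomputable def subspaceDist {n : ℕ} (V W : Submodule ℂ (Vec n)) : ℝ :=
  ‖V.starProjection - W.starProjection‖

open Classical in
/-- The point of minimal norm of a nonempty affine subspace. -/
noncomputable def minNormPoint {n : ℕ} (s : AffineSubspace ℂ (Vec n)) : Vec n :=
  if h : (s : Set (Vec n)).Nonempty then s.directionᗮ.starProjection h.some else 0

theorem minNormPoint_mem {n : ℕ} {s : AffineSubspace ℂ (Vec n)} (h : (s : Set (Vec n)).Nonempty) :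
    minNormPoint s ∈ s ∧ minNormPoint s ∈ s.directionᗮ := by
  rw [minNormPoint, dif_pos h]
  refine ⟨?_, Submodule.starProjection_apply_mem _ _⟩
  have h1 : s.directionᗮ.starProjection h.some
      = -(s.direction.starProjection h.some) +ᵥ h.some := by
    rw [Submodule.starProjection_orthogonal_val, vadd_eq_add]; abel
  rw [h1]
  exact AffineSubspace.vadd_mem_of_mem_direction
    (s.direction.neg_mem (Submodule.starProjection_apply_mem _ _)) h.some_mem

/-- The distance in the affine Grassmannian: the maximum of the distance of the points of minimal
norm and the distance of the directions. It is `0` for two empty sets. -/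
noncomputable def affineDist {n : ℕ} (s t : AffineSubspace ℂ (Vec n)) : ℝ :=
  max ‖minNormPoint s - minNormPoint t‖ (subspaceDist s.direction t.direction)

/-- The norm `√(‖A‖² + ‖b‖²)` of a pair of a matrix and a vector. -/
noncomputable def pairNorm {m n : ℕ} (A : Mat m n) (b : Vec m) : ℝ := √(‖A‖ ^ 2 + ‖b‖ ^ 2)

end NumLinSys

open NumLinSys

/-!
Write `δ = ‖A - A'‖`, `τ = ‖A†‖⁻¹ - δ`, let `V` be the orthogonal complement of the kernel of `A`,
and let `V'` be the span of the right singular vectors of `A'` with singular values above `β`.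

On `ker A` the matrix `A'` stretches by at most `δ`, and on `V` by at least `τ`. On `V'` it stretches
by more than `β`, and on the orthogonal complement of `V'` by at most `β`. With any threshold
in `[δ, τ)` in place of `β`, this leaves only zero in two intersections, and counting dimensions gives
`dim V' = dim V = rank A` (`card_sv_gt_eq_rank`). As the count is the same for all these thresholds,
`A'` has no singular value in `(δ, τ)`; in particular `β` is not one, and the `β`-projection `B` of
`A'`, which is `A'` composed with the orthogonal projection onto `V'` (`lin_thetaProj`), satisfies
`‖A' - B‖ ≤ δ`. The backward error bound follows.

For the forward error, each `v ∈ V'` is `A'ᴴ y` with `‖y‖ ≤ ‖v‖ / τ`, and pairing with the component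
of `v` in `ker A` shows that this component has norm at most `(δ / τ) ‖v‖`
(`norm_sub_starProjection_le_of_mem_rightSpace`). Since `V` and `V'` have the same dimension and
`δ / τ < 1`, the same gap bound holds with `V` and `V'` exchanged
(`norm_sub_starProjection_le_symm`) and for the difference of the two projections
(`norm_starProjection_sub_starProjection_le`). The distance of the minimal norm solutions `x'` and
`x = A†b` is split at the projection `p` of `x` to `V'`: `‖x' - p‖` is bounded through the lower
bound `τ` of `A'` on `V'` (`norm_minNormPoint_sub_starProjection_le`), and `‖p - x‖` by the gap. The
sum is at most `(2 ‖x‖ δ + ‖b' - b‖) / τ`, and the Cauchy-Schwarz inequality gives the square root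
of the statement (`affineDist_sol_le`).
-/

namespace NumLinSys

/-! ### The gap between subspaces of equal dimension -/

section SubspaceGap

variable {E : Type*} [NormedAddCommGroup E] [InnerProductSpace ℂ E] [FiniteDimensional ℂ E]

theorem norm_sub_starProjection_le_norm_sub (W : Submodule ℂ E) (x : E) {w : E} (hw : w ∈ W) :
    ‖x - W.starProjection x‖ ≤ ‖x - w‖ := by
  rw [W.starProjection_minimal x]
  exact ciInf_le ⟨0, by rintro _ ⟨y, rfl⟩; exact norm_nonneg _⟩ (⟨w, hw⟩ : W)

theorem norm_sq_eq_starProjection_add (W : Submodule ℂ E) (x : E) :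
    ‖x‖ ^ 2 = ‖W.starProjection x‖ ^ 2 + ‖x - W.starProjection x‖ ^ 2 := by
  rw [W.norm_sq_eq_add_norm_sq_starProjection x, W.starProjection_orthogonal_val]

/-- For subspaces of equal dimension, the one-sided gap is symmetric as long as it is below `1`: the
projection to `V` is then a bijection of `W` onto `V`, and if `x ∈ V` is the projection of `v ∈ W`,
a multiple of `v` is close enough to `x`. -/
theorem norm_sub_starProjection_le_symm {V W : Submodule ℂ E}
    (hVW : Module.finrank ℂ V = Module.finrank ℂ W) {c : ℝ} (hc0 : 0 ≤ c) (hc1 : c < 1)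
    (h : ∀ v ∈ W, ‖v - V.starProjection v‖ ≤ c * ‖v‖) {x : E} (hx : x ∈ V) :
    ‖x - W.starProjection x‖ ≤ c * ‖x‖ := by
  let T : W →ₗ[ℂ] V := (V.starProjection.toLinearMap ∘ₗ W.subtype).codRestrict V
    (fun v => V.starProjection_apply_mem _)
  have hT : ∀ v : W, (T v : E) = V.starProjection v := fun v => rfl
  have hinj : Function.Injective T := by
    rw [← LinearMap.ker_eq_bot, LinearMap.ker_eq_bot']
    intro v hv
    have h1 : V.starProjection (v : E) = 0 := by rw [← hT, hv]; rfl
    have h2 := h v v.2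
    rw [h1, sub_zero] at h2
    have h3 : ‖(v : E)‖ = 0 := by nlinarith [norm_nonneg (v : E)]
    exact Subtype.ext (norm_eq_zero.1 h3)
  obtain ⟨v, hv⟩ :=
    (LinearMap.injective_iff_surjective_of_finrank_eq_finrank hVW.symm).1 hinj ⟨x, hx⟩
  have hxv : V.starProjection (v : E) = x := by rw [← hT, hv]
  rcases eq_or_ne x 0 with rfl | hx0
  · simp
  have ha : 0 < ‖x‖ := norm_pos_iff.2 hx0
  have hpy := norm_sq_eq_starProjection_add V (v : E)
  rw [hxv] at hpy
  have hb : 0 < ‖(v : E)‖ := by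
    by_contra hb
    have : ‖(v : E)‖ = 0 := le_antisymm (not_lt.1 hb) (norm_nonneg _)
    rw [this] at hpy
    nlinarith [sq_nonneg ‖(v : E) - x‖]
  have h2 := h v v.2
  rw [hxv] at h2
  have h3 : ‖(v : E)‖ ^ 2 - ‖x‖ ^ 2 ≤ c ^ 2 * ‖(v : E)‖ ^ 2 := by
    have := pow_le_pow_left₀ (norm_nonneg _) h2 2
    rw [mul_pow] at this
    linarith
  have hin : inner ℂ x (v : E) = ((‖x‖ ^ 2 : ℝ) : ℂ) := by
    have h4 := V.starProjection_inner_eq_zero (v : E) x hx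
    rw [hxv, inner_sub_left, sub_eq_zero] at h4
    rw [← inner_conj_symm, h4, inner_self_eq_norm_sq_to_K]
    simp
  -- The multiple of `v` that is closest to `x`, as `⟪x, v⟫ = ‖x‖²`.
  have hmem : ((‖x‖ ^ 2 / ‖(v : E)‖ ^ 2 : ℝ) : ℂ) • (v : E) ∈ W := W.smul_mem _ v.2
  refine (norm_sub_starProjection_le_norm_sub W x hmem).trans ?_
  refine (pow_le_pow_iff_left₀ (norm_nonneg _) (by positivity) two_ne_zero).1 ?_
  rw [@norm_sub_sq ℂ, inner_smul_right, hin, ← Complex.ofReal_mul, norm_smul, Complex.norm_real,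
    Real.norm_of_nonneg (by positivity)]
  simp only [RCLike.re_to_complex, Complex.ofReal_re]
  have h5 : ‖x‖ ^ 2 - 2 * (‖x‖ ^ 2 / ‖(v : E)‖ ^ 2 * ‖x‖ ^ 2)
      + (‖x‖ ^ 2 / ‖(v : E)‖ ^ 2 * ‖(v : E)‖) ^ 2
      = ‖x‖ ^ 2 / ‖(v : E)‖ ^ 2 * (‖(v : E)‖ ^ 2 - ‖x‖ ^ 2) := by
    field_simp; ring
  have h6 : ‖x‖ ^ 2 / ‖(v : E)‖ ^ 2 * (c ^ 2 * ‖(v : E)‖ ^ 2) = (c * ‖x‖) ^ 2 := by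
    field_simp
  rw [h5, ← h6]
  gcongr

/-- The difference of the projections at `w` splits orthogonally into the part of `P_W w` outside
`V` and the part in `V` of the component of `w` orthogonal to `W`; both are bounded by the gap. -/
theorem norm_starProjection_sub_starProjection_le {V W : Submodule ℂ E}
    (hVW : Module.finrank ℂ V = Module.finrank ℂ W) {c : ℝ} (hc0 : 0 ≤ c) (hc1 : c < 1)
    (h : ∀ v ∈ W, ‖v - V.starProjection v‖ ≤ c * ‖v‖) :
    ‖W.starProjection - V.starProjection‖ ≤ c := by
  have h' : ∀ x ∈ V, ‖x - W.starProjection x‖ ≤ c * ‖x‖ := fun x hx =>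
    norm_sub_starProjection_le_symm hVW hc0 hc1 h hx
  refine ContinuousLinearMap.opNorm_le_bound _ hc0 fun w => ?_
  set p := W.starProjection w with hp
  have hpW : p ∈ W := W.starProjection_apply_mem w
  set e := w - p with he
  set q := V.starProjection e with hq
  have hqV : q ∈ V := V.starProjection_apply_mem e
  have heW : e ∈ Wᗮ := W.sub_starProjection_mem_orthogonal w
  -- By duality, `h'` also bounds the projection to `V` of vectors orthogonal to `W`.
  have h1 : ‖q‖ ≤ c * ‖e‖ := by
    have h2 : inner ℂ q q = inner ℂ (q - W.starProjection q) e := by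
      rw [inner_sub_left, Submodule.inner_right_of_mem_orthogonal
        (W.starProjection_apply_mem q) heW, sub_zero]
      conv_lhs => rw [hq, ← V.inner_starProjection_left_eq_right]
      rw [← hq, V.starProjection_eq_self_iff.2 hqV]
    have h3 : ‖q‖ * ‖q‖ ≤ c * ‖q‖ * ‖e‖ := by
      have h4 : ‖q‖ * ‖q‖ = ‖inner ℂ q q‖ := by
        rw [inner_self_eq_norm_sq_to_K]; simp [sq]
      rw [h4, h2]
      exact (norm_inner_le_norm _ _).trans
        (mul_le_mul_of_nonneg_right (h' q hqV) (norm_nonneg _))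
    rcases (norm_nonneg q).eq_or_lt with h0 | h0
    · rw [← h0]; positivity
    · refine le_of_mul_le_mul_left ?_ h0
      linarith
  have hsplit : (W.starProjection - V.starProjection) w = (p - V.starProjection p) - q := by
    rw [sub_apply, hq, he, map_sub]; abel
  have horth : inner ℂ (p - V.starProjection p) q = 0 :=
    V.starProjection_inner_eq_zero p q hqV
  have hpy := norm_sq_eq_starProjection_add W w
  rw [← hp, ← he] at hpy
  have hsq : ‖(p - V.starProjection p) - q‖ ^ 2 ≤ (c * ‖w‖) ^ 2 := by
    rw [@norm_sub_sq ℂ, horth]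
    have h5 := pow_le_pow_left₀ (norm_nonneg _) (h p hpW) 2
    have h6 := pow_le_pow_left₀ (norm_nonneg _) h1 2
    rw [mul_pow] at h5 h6 ⊢
    rw [hpy]
    simp only [map_zero]
    linarith
  rw [hsplit]
  exact (pow_le_pow_iff_left₀ (norm_nonneg _) (by positivity) two_ne_zero).1 hsq

end SubspaceGap

/-! ### Norm and rank of the linear map of a matrix -/

section Matrices

variable {m n : ℕ}

theorem norm_lin_le (A : Mat m n) (x : Vec n) : ‖lin A x‖ ≤ ‖A‖ * ‖x‖ :=
  A.l2_opNorm_mulVec x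

theorem norm_le_of_norm_lin_le (A : Mat m n) {c : ℝ} (hc : 0 ≤ c)
    (h : ∀ x, ‖lin A x‖ ≤ c * ‖x‖) : ‖A‖ ≤ c := by
  rw [Matrix.l2_opNorm_def]
  exact ContinuousLinearMap.opNorm_le_bound _ hc h

theorem lin_sub_apply (A B : Mat m n) (x : Vec n) : lin (A - B) x = lin A x - lin B x := by
  rw [lin, map_sub, LinearMap.sub_apply]

theorem lin_mul_apply {k : ℕ} (A : Mat m n) (B : Mat n k) (x : Vec k) :
    lin (A * B) x = lin A (lin B x) := by
  simp [Matrix.toLpLin_apply]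

theorem finrank_range_lin (A : Mat m n) :
    Module.finrank ℂ (LinearMap.range (lin A)) = A.rank := by
  rw [lin, Matrix.toEuclideanLin_eq_toLin_orthonormal, ← Matrix.rank_eq_finrank_range_toLin]

theorem finrank_ker_lin (A : Mat m n) :
    Module.finrank ℂ (LinearMap.ker (lin A)) = n - A.rank := by
  have h := (lin A).finrank_range_add_finrank_ker
  rw [finrank_range_lin, finrank_euclideanSpace_fin] at h
  omega

theorem finrank_orthogonal_ker_lin (A : Mat m n) :
    Module.finrank ℂ (LinearMap.ker (lin A))ᗮ = A.rank := by
  have h := (lin A).finrank_range_add_finrank_ker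
  have h' := (LinearMap.ker (lin A)).finrank_add_finrank_orthogonal
  rw [finrank_range_lin] at h
  omega

end Matrices

/-! ### The Moore-Penrose inverse -/

section MoorePenrose

variable {m n : ℕ} (A : Mat m n)

theorem lin_pinv_mem_orthogonal_ker (y : Vec m) :
    lin (pinv A) y ∈ (LinearMap.ker (lin A))ᗮ := by
  intro w hw
  have h1 : lin (pinv A) y = lin (pinv A * A) (lin (pinv A) y) := by
    rw [← lin_mul_apply, (pinv_spec A).mul_mul_right]
  have h2 : LinearMap.adjoint (lin (pinv A * A)) = lin (pinv A * A) := by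
    rw [lin, ← Matrix.toEuclideanLin_conjTranspose_eq_adjoint, (pinv_spec A).hermitian_right]
  rw [h1, ← LinearMap.adjoint_inner_left, h2, lin_mul_apply, LinearMap.mem_ker.1 hw, map_zero,
    inner_zero_left]

theorem lin_lin_pinv_of_mem_range {b : Vec m} (hb : b ∈ LinearMap.range (lin A)) :
    lin A (lin (pinv A) b) = b := by
  obtain ⟨x, rfl⟩ := hb
  rw [← lin_mul_apply, ← lin_mul_apply, (pinv_spec A).mul_mul_left]

theorem lin_pinv_lin_of_mem_orthogonal_ker {x : Vec n} (hx : x ∈ (LinearMap.ker (lin A))ᗮ) :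
    lin (pinv A) (lin A x) = x := by
  have h1 : x - lin (pinv A) (lin A x) ∈ LinearMap.ker (lin A) := by
    rw [LinearMap.mem_ker, map_sub, lin_lin_pinv_of_mem_range A ⟨x, rfl⟩, sub_self]
  have h2 : x - lin (pinv A) (lin A x) ∈ (LinearMap.ker (lin A))ᗮ :=
    Submodule.sub_mem _ hx (lin_pinv_mem_orthogonal_ker A _)
  have h3 := Submodule.inner_right_of_mem_orthogonal h1 h2
  exact (sub_eq_zero.1 (inner_self_eq_zero.1 h3)).symm

theorem norm_le_norm_pinv_mul {x : Vec n} (hx : x ∈ (LinearMap.ker (lin A))ᗮ) :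
    ‖x‖ ≤ ‖pinv A‖ * ‖lin A x‖ := by
  conv_lhs => rw [← lin_pinv_lin_of_mem_orthogonal_ker A hx]
  exact norm_lin_le _ _

theorem norm_pinv_pos (hA : A ≠ 0) : 0 < ‖pinv A‖ := by
  rw [norm_pos_iff]
  intro h
  apply hA
  rw [← (pinv_spec A).mul_mul_left, h, Matrix.mul_zero, Matrix.zero_mul]

end MoorePenrose

/-! ### Solution sets of consistent systems -/

section SolutionSets

variable {m n : ℕ}

theorem direction_sol {A : Mat m n} {b : Vec m} (hb : b ∈ LinearMap.range (lin A)) :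
    (sol A b).direction = LinearMap.ker (lin A) := by
  obtain ⟨x, hx⟩ := hb
  have hx' : x ∈ sol A b := hx
  ext v
  rw [← AffineSubspace.vadd_mem_iff_mem_direction v hx', LinearMap.mem_ker]
  change lin A (v + x) = b ↔ _
  rw [map_add, hx, add_eq_right]

theorem sol_mem_affineGrassmannian {A : Mat m n} {b : Vec m}
    (hb : b ∈ LinearMap.range (lin A)) : sol A b ∈ affineGrassmannian (n - A.rank) n := by
  refine ⟨hb, ?_⟩
  rw [direction_sol hb, finrank_ker_lin]

theorem minNormPoint_sol_eq {A : Mat m n} {x : Vec n} (hx : x ∈ (LinearMap.ker (lin A))ᗮ) :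
    minNormPoint (sol A (lin A x)) = x := by
  have hb : lin A x ∈ LinearMap.range (lin A) := ⟨x, rfl⟩
  obtain ⟨h1, h2⟩ := minNormPoint_mem (s := sol A (lin A x)) ⟨x, rfl⟩
  rw [direction_sol hb] at h2
  have h3 : lin A (minNormPoint (sol A (lin A x))) = lin A x := h1
  have h4 : minNormPoint (sol A (lin A x)) - x ∈ LinearMap.ker (lin A) := by
    rw [LinearMap.mem_ker, map_sub, h3, sub_self]
  exact sub_eq_zero.1 (inner_self_eq_zero.1
    (Submodule.inner_right_of_mem_orthogonal h4 (Submodule.sub_mem _ h2 hx)))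

end SolutionSets

/-! ### Singular vectors and the projection within a tolerance -/

section SingularVectors

variable {m n : ℕ} (θ : ℝ) (G : Mat m n)

theorem sv_nonneg (j : ℕ) : 0 ≤ sv G j := LinearMap.singularValues_nonneg _ _

theorem norm_sq_lin (x : Vec n) :
    ‖lin G x‖ ^ 2 = ∑ j : Fin n, sv G j ^ 2 * ‖inner ℂ (rightVec G j) x‖ ^ 2 := by
  have h : ((‖lin G x‖ ^ 2 : ℝ) : ℂ)
      = ((∑ j : Fin n, sv G j ^ 2 * ‖inner ℂ (rightVec G j) x‖ ^ 2 : ℝ) : ℂ) := by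
    have h1 : ((‖lin G x‖ ^ 2 : ℝ) : ℂ) = inner ℂ (lin G x) (lin G x) := by
      rw [inner_self_eq_norm_sq_to_K]; simp
    rw [h1, ← LinearMap.adjoint_inner_left, ← (rightVec G).sum_inner_mul_inner, Complex.ofReal_sum]
    refine Finset.sum_congr rfl fun j _ => ?_
    rw [LinearMap.adjoint_inner_left, ← LinearMap.adjoint_inner_right, adjoint_lin_rightVec,
      inner_smul_right, ← inner_conj_symm x]
    push_cast
    rw [mul_assoc, Complex.conj_mul']
  exact_mod_cast h

theorem inner_lin_lin_rightVec (x : Vec n) (j : Fin n) :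
    inner ℂ (lin G x) (lin G (rightVec G j)) = (sv G j ^ 2 : ℂ) * inner ℂ x (rightVec G j) := by
  rw [← LinearMap.adjoint_inner_right, adjoint_lin_rightVec, inner_smul_right]

/-- The span of the right singular vectors of `G` whose singular values exceed `θ`. -/
def rightSpace : Submodule ℂ (Vec n) :=
  Submodule.span ℂ (rightVec G '' {j | θ < sv G j})

theorem rightVec_mem_rightSpace {j : Fin n} (hj : θ < sv G j) : rightVec G j ∈ rightSpace θ G :=
  Submodule.subset_span ⟨j, hj, rfl⟩

theorem mem_orthogonal_rightSpace {x : Vec n} :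
    x ∈ (rightSpace θ G)ᗮ ↔ ∀ j : Fin n, θ < sv G j → inner ℂ (rightVec G j) x = 0 := by
  refine ⟨fun h j hj => h _ (rightVec_mem_rightSpace θ G hj), fun h => ?_⟩
  intro v hv
  induction hv using Submodule.span_induction with
  | mem v hv => obtain ⟨j, hj, rfl⟩ := hv; exact h j hj
  | zero => exact inner_zero_left _
  | add u v _ _ hu hv => rw [inner_add_left, hu, hv, add_zero]
  | smul c v _ hv => rw [inner_smul_left, hv, mul_zero]

theorem rightVec_mem_orthogonal_rightSpace {j : Fin n} (hj : ¬ θ < sv G j) :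
    rightVec G j ∈ (rightSpace θ G)ᗮ := by
  rw [mem_orthogonal_rightSpace]
  intro i hi
  exact (rightVec G).orthonormal.2 (by rintro rfl; exact hj hi)

theorem inner_rightVec_eq_zero {x : Vec n} (hx : x ∈ rightSpace θ G) {j : Fin n}
    (hj : ¬ θ < sv G j) : inner ℂ (rightVec G j) x = 0 :=
  Submodule.inner_left_of_mem_orthogonal hx (rightVec_mem_orthogonal_rightSpace θ G hj)

theorem finrank_rightSpace :
    Module.finrank ℂ (rightSpace θ G)
      = (Finset.univ.filter (fun j : Fin n => θ < sv G j)).card := by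
  have hli : LinearIndependent ℂ (fun j : {j : Fin n | θ < sv G j} => rightVec G j) :=
    (rightVec G).orthonormal.linearIndependent.comp _ Subtype.val_injective
  have h := finrank_span_eq_card hli
  rw [show Set.range (fun j : {j : Fin n | θ < sv G j} => rightVec G j)
    = rightVec G '' {j | θ < sv G j} by ext; simp] at h
  rw [rightSpace, h]
  exact Fintype.card_subtype _

theorem lin_thetaProj_rightVec (j : Fin n) :
    lin (thetaProj θ G) (rightVec G j) = if θ < sv G j then lin G (rightVec G j) else 0 := by
  have hterm : ∀ i : Fin n, lin ((sv G i : ℂ) • Matrix.vecMulVec (WithLp.ofLp (leftVec G i))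
      (star (WithLp.ofLp (rightVec G i)))) (rightVec G j)
      = if i = j then lin G (rightVec G j) else 0 := by
    intro i
    have h := orthonormal_iff_ite.1 (rightVec G).orthonormal i j
    rw [EuclideanSpace.inner_eq_star_dotProduct] at h
    rw [lin, map_smul, LinearMap.smul_apply, Matrix.toLpLin_apply,
      Matrix.vecMulVec_mulVec, dotProduct_comm, h]
    split_ifs with hij
    · subst hij
      rw [lin_rightVec]
      simp
    · simp
  rw [lin, thetaProj, map_sum, LinearMap.sum_apply, Finset.sum_congr rfl fun i _ => hterm i,
    Finset.sum_ite_eq']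
  simp

/-- The `θ`-projection of `G` is `G` restricted to the right singular vectors with singular values
beyond `θ`. -/
theorem lin_thetaProj (x : Vec n) :
    lin (thetaProj θ G) x = lin G ((rightSpace θ G).starProjection x) := by
  have h : lin (thetaProj θ G) = lin G ∘ₗ (rightSpace θ G).starProjection.toLinearMap := by
    refine (rightVec G).toBasis.ext fun j => ?_
    rw [OrthonormalBasis.coe_toBasis, lin_thetaProj_rightVec, LinearMap.comp_apply,
      ContinuousLinearMap.coe_coe]
    split_ifs with hj
    · rw [Submodule.starProjection_eq_self_iff.2 (rightVec_mem_rightSpace θ G hj)]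
    · rw [(rightSpace θ G).starProjection_apply_eq_zero_iff.2
        (rightVec_mem_orthogonal_rightSpace θ G hj), map_zero]
  rw [h]; rfl

theorem inner_lin_lin_eq_zero {v w : Vec n} (hv : v ∈ rightSpace θ G)
    (hw : w ∈ (rightSpace θ G)ᗮ) : inner ℂ (lin G w) (lin G v) = 0 := by
  induction hv using Submodule.span_induction with
  | mem v hv =>
    obtain ⟨j, hj, rfl⟩ := hv
    rw [inner_lin_lin_rightVec, Submodule.inner_left_of_mem_orthogonal
      (rightVec_mem_rightSpace θ G hj) hw, mul_zero]
  | zero => simp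
  | add u v _ _ hu hv => rw [map_add, inner_add_right, hu, hv, add_zero]
  | smul c v _ hv => rw [map_smul, inner_smul_right, hv, mul_zero]

/-- The Gram operator `GᴴG` maps the span of the leading right singular vectors onto itself. -/
theorem exists_adjoint_lin_lin_eq (hθ : 0 ≤ θ) {v : Vec n} (hv : v ∈ rightSpace θ G) :
    ∃ z ∈ rightSpace θ G, (lin G).adjoint (lin G z) = v := by
  induction hv using Submodule.span_induction with
  | mem v hv =>
    obtain ⟨j, hj, rfl⟩ := hv
    have hj0 : (sv G j : ℂ) ≠ 0 := by exact_mod_cast (hθ.trans_lt hj).ne'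
    refine ⟨((sv G j : ℂ) ^ 2)⁻¹ • rightVec G j,
      Submodule.smul_mem _ _ (rightVec_mem_rightSpace θ G hj), ?_⟩
    rw [map_smul, map_smul, adjoint_lin_rightVec, smul_smul, inv_mul_cancel₀ (pow_ne_zero 2 hj0),
      one_smul]
  | zero => exact ⟨0, Submodule.zero_mem _, by simp⟩
  | add u v _ _ hu hv =>
    obtain ⟨y, hy, hy'⟩ := hu
    obtain ⟨z, hz, hz'⟩ := hv
    exact ⟨y + z, Submodule.add_mem _ hy hz, by rw [map_add, map_add, hy', hz']⟩
  | smul c v _ hv =>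
    obtain ⟨z, hz, hz'⟩ := hv
    exact ⟨c • z, Submodule.smul_mem _ _ hz, by rw [map_smul, map_smul, hz']⟩

/-- A lower bound of the singular values above `θ` is a lower bound of `G` on the span of the
corresponding right singular vectors. -/
theorem mul_norm_le_norm_lin {s : ℝ} (hs : 0 ≤ s) (h : ∀ j : Fin n, θ < sv G j → s ≤ sv G j)
    {v : Vec n} (hv : v ∈ rightSpace θ G) : s * ‖v‖ ≤ ‖lin G v‖ := by
  refine (pow_le_pow_iff_left₀ (by positivity) (norm_nonneg _) two_ne_zero).1 ?_
  rw [mul_pow, norm_sq_lin, ← (rightVec G).sum_sq_norm_inner_right v, Finset.mul_sum]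
  refine Finset.sum_le_sum fun j _ => ?_
  by_cases hj : θ < sv G j
  · have := h j hj
    gcongr
  · rw [inner_rightVec_eq_zero θ G hv hj]; simp

/-- An upper bound of the singular values up to `θ` bounds `G` on the orthogonal complement of
`rightSpace θ G`. -/
theorem norm_lin_le_mul {s : ℝ} (hs : 0 ≤ s) (h : ∀ j : Fin n, ¬ θ < sv G j → sv G j ≤ s)
    {w : Vec n} (hw : w ∈ (rightSpace θ G)ᗮ) : ‖lin G w‖ ≤ s * ‖w‖ := by
  refine (pow_le_pow_iff_left₀ (norm_nonneg _) (by positivity) two_ne_zero).1 ?_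
  rw [mul_pow, norm_sq_lin, ← (rightVec G).sum_sq_norm_inner_right w, Finset.mul_sum]
  refine Finset.sum_le_sum fun j _ => ?_
  by_cases hj : θ < sv G j
  · rw [(mem_orthogonal_rightSpace θ G).1 hw j hj]; simp
  · have := h j hj
    have := sv_nonneg G j
    gcongr

/-- On `rightSpace θ G`, the map `G` stretches every nonzero vector by strictly more than `θ`. -/
theorem eq_zero_of_norm_lin_le (hθ : 0 ≤ θ) {v : Vec n} (hv : v ∈ rightSpace θ G)
    (h : ‖lin G v‖ ≤ θ * ‖v‖) : v = 0 := by
  by_contra hv0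
  have hpos : 0 < ‖v‖ := norm_pos_iff.2 hv0
  obtain ⟨j₀, hj₀, hj₀'⟩ : ∃ j : Fin n, θ < sv G j ∧ inner ℂ (rightVec G j) v ≠ 0 := by
    by_contra hne
    push Not at hne
    exact hv0 (inner_self_eq_zero.1 (Submodule.inner_right_of_mem_orthogonal hv
      ((mem_orthogonal_rightSpace θ G).2 hne)))
  have h1 : (θ * ‖v‖) ^ 2 < ‖lin G v‖ ^ 2 := by
    rw [mul_pow, norm_sq_lin, ← (rightVec G).sum_sq_norm_inner_right v, Finset.mul_sum]
    refine Finset.sum_lt_sum (fun j _ => ?_) ⟨j₀, Finset.mem_univ _, ?_⟩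
    · by_cases hj : θ < sv G j
      · gcongr
      · rw [inner_rightVec_eq_zero θ G hv hj]; simp
    · have : 0 < ‖inner ℂ (rightVec G j₀) v‖ := norm_pos_iff.2 hj₀'
      gcongr
  exact absurd h1 (not_lt.2 (pow_le_pow_left₀ (norm_nonneg _) h 2))

theorem ker_lin_thetaProj (hθ : 0 ≤ θ) :
    LinearMap.ker (lin (thetaProj θ G)) = (rightSpace θ G)ᗮ := by
  ext x
  rw [LinearMap.mem_ker, lin_thetaProj, ← (rightSpace θ G).starProjection_apply_eq_zero_iff]
  refine ⟨fun h => ?_, fun h => by rw [h, map_zero]⟩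
  refine eq_zero_of_norm_lin_le θ G hθ (Submodule.starProjection_apply_mem _ _) ?_
  rw [h, norm_zero]
  positivity

end SingularVectors

/-! ### Singular values under perturbation -/

section Perturbation

variable {m n : ℕ} {A A' : Mat m n}

theorem norm_lin_le_of_mem_ker {w : Vec n} (hw : w ∈ LinearMap.ker (lin A)) :
    ‖lin A' w‖ ≤ ‖A - A'‖ * ‖w‖ := by
  have h := norm_lin_le (A - A') w
  rwa [lin_sub_apply, LinearMap.mem_ker.1 hw, zero_sub, norm_neg] at h

theorem mul_norm_le_norm_lin_of_mem_orthogonal_ker (hA : A ≠ 0) {x : Vec n}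
    (hx : x ∈ (LinearMap.ker (lin A))ᗮ) :
    (‖pinv A‖⁻¹ - ‖A - A'‖) * ‖x‖ ≤ ‖lin A' x‖ := by
  have h1 : ‖pinv A‖⁻¹ * ‖x‖ ≤ ‖lin A x‖ := by
    rw [inv_mul_le_iff₀ (norm_pinv_pos A hA)]
    exact norm_le_norm_pinv_mul A hx
  have h2 := norm_lin_le (A - A') x
  rw [lin_sub_apply] at h2
  have h3 := norm_sub_norm_le (lin A x) (lin A' x)
  rw [sub_mul]
  linarith

/-- The number of singular values of `A'` above a threshold in `[‖A - A'‖, ‖A†‖⁻¹ - ‖A - A'‖)` is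
the rank of `A`: `rightSpace t A'` meets `ker A` trivially, and so do their orthogonal
complements. -/
theorem card_sv_gt_eq_rank (hA : A ≠ 0) {t : ℝ} (h1 : ‖A - A'‖ ≤ t)
    (h2 : t < ‖pinv A‖⁻¹ - ‖A - A'‖) :
    (Finset.univ.filter (fun j : Fin n => t < sv A' j)).card = A.rank := by
  have ht : 0 ≤ t := (norm_nonneg _).trans h1
  have hd1 : Disjoint (rightSpace t A') (LinearMap.ker (lin A)) := by
    rw [Submodule.disjoint_def]
    intro v hv hv'
    exact eq_zero_of_norm_lin_le t A' ht hv ((norm_lin_le_of_mem_ker hv').trans (by gcongr))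
  have hd2 : Disjoint (rightSpace t A')ᗮ (LinearMap.ker (lin A))ᗮ := by
    rw [Submodule.disjoint_def]
    intro v hv hv'
    have h3 := norm_lin_le_mul t A' ht (fun j hj => not_lt.1 hj) hv
    have h4 := mul_norm_le_norm_lin_of_mem_orthogonal_ker (A' := A') hA hv'
    by_contra hv0
    have hpos : 0 < ‖v‖ := norm_pos_iff.2 hv0
    nlinarith
  have e1 := Submodule.finrank_add_finrank_le_of_disjoint hd1
  have e2 := Submodule.finrank_add_finrank_le_of_disjoint hd2
  have e3 := (rightSpace t A').finrank_add_finrank_orthogonal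
  have e4 := (LinearMap.ker (lin A)).finrank_add_finrank_orthogonal
  rw [finrank_orthogonal_ker_lin] at e2 e4
  rw [← finrank_rightSpace]
  omega

/-- No singular value of `A'` lies between two thresholds that count the same number of them. -/
theorem sv_gt_iff_sv_gt (hA : A ≠ 0) {s t : ℝ} (h1 : ‖A - A'‖ ≤ s) (hst : s ≤ t)
    (h2 : t < ‖pinv A‖⁻¹ - ‖A - A'‖) (j : Fin n) : s < sv A' j ↔ t < sv A' j := by
  have hsub : Finset.univ.filter (fun j : Fin n => t < sv A' j)
      ⊆ Finset.univ.filter (fun j : Fin n => s < sv A' j) := fun i hi => by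
    simp only [Finset.mem_filter, Finset.mem_univ, true_and] at hi ⊢
    exact hst.trans_lt hi
  have heq := Finset.eq_of_subset_of_card_le hsub (by
    rw [card_sv_gt_eq_rank hA h1 (hst.trans_lt h2), card_sv_gt_eq_rank hA (h1.trans hst) h2])
  have := congrArg (j ∈ ·) heq
  simpa using this.symm

variable {β : ℝ}

theorem le_sv_of_lt_sv (hA : A ≠ 0) (h1 : ‖A - A'‖ ≤ β) (j : Fin n) (hj : β < sv A' j) :
    ‖pinv A‖⁻¹ - ‖A - A'‖ ≤ sv A' j := by
  by_contra hlt
  push Not at hlt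
  exact lt_irrefl _ ((sv_gt_iff_sv_gt hA h1 hj.le hlt j).1 hj)

theorem sv_le_of_not_lt_sv (hA : A ≠ 0) (h1 : ‖A - A'‖ ≤ β) (h2 : β < ‖pinv A‖⁻¹ - ‖A - A'‖)
    (j : Fin n) (hj : ¬ β < sv A' j) : sv A' j ≤ ‖A - A'‖ := by
  rw [← sv_gt_iff_sv_gt hA le_rfl h1 h2] at hj
  exact not_lt.1 hj

theorem sv_ne (hA : A ≠ 0) (h1 : ‖A - A'‖ < β) (h2 : β < ‖pinv A‖⁻¹ - ‖A - A'‖) (j : ℕ) :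
    sv A' j ≠ β := by
  intro h
  have hβ : 0 < β := (norm_nonneg _).trans_lt h1
  by_cases hj : j < n
  · have := sv_le_of_not_lt_sv hA h1.le h2 ⟨j, hj⟩ (by simp [h])
    rw [h] at this
    linarith
  -- Beyond the index `n` the singular values are zero by convention, and `0 < β`.
  · have : sv A' j = 0 := LinearMap.singularValues_of_finrank_le _ (by simpa using hj)
    linarith

end Perturbation

/-! ### The gap between the row spaces -/

section Gap

variable {m n : ℕ} {A A' : Mat m n} {β : ℝ}

theorem finrank_orthogonal_ker_eq_finrank_rightSpace (hA : A ≠ 0) (h1 : ‖A - A'‖ ≤ β)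
    (h2 : β < ‖pinv A‖⁻¹ - ‖A - A'‖) :
    Module.finrank ℂ (LinearMap.ker (lin A))ᗮ = Module.finrank ℂ (rightSpace β A') := by
  rw [finrank_orthogonal_ker_lin, finrank_rightSpace, card_sv_gt_eq_rank hA h1 h2]

/-- The vectors of `rightSpace β A'` are close to the orthogonal complement of `ker A`: a vector
`v = A'ᴴ (A' z)` is paired with its component in `ker A`, on which `A'` and `A' - A` agree. -/
theorem norm_sub_starProjection_le_of_mem_rightSpace (hA : A ≠ 0) (h1 : ‖A - A'‖ ≤ β)
    (h2 : β < ‖pinv A‖⁻¹ - ‖A - A'‖) {v : Vec n} (hv : v ∈ rightSpace β A') :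
    ‖v - (LinearMap.ker (lin A))ᗮ.starProjection v‖
      ≤ ‖A - A'‖ / (‖pinv A‖⁻¹ - ‖A - A'‖) * ‖v‖ := by
  set V := (LinearMap.ker (lin A))ᗮ with hV
  set δ := ‖A - A'‖ with hδ
  set τ := ‖pinv A‖⁻¹ - δ with hτ
  have hδ0 : 0 ≤ δ := norm_nonneg _
  have hτ0 : 0 < τ := (hδ0.trans h1).trans_lt h2
  have hlow : ∀ z ∈ rightSpace β A', τ * ‖z‖ ≤ ‖lin A' z‖ := fun z hz =>
    mul_norm_le_norm_lin β A' hτ0.le (le_sv_of_lt_sv hA h1) hz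
  obtain ⟨z, hz, hzv⟩ := exists_adjoint_lin_lin_eq β A' (hδ0.trans h1) hv
  have hy : ‖lin A' z‖ ≤ ‖v‖ / τ := by
    have e1 : ‖lin A' z‖ * ‖lin A' z‖ = ‖inner ℂ z v‖ := by
      rw [← hzv, LinearMap.adjoint_inner_right, inner_self_eq_norm_sq_to_K]; simp [sq]
    have e2 := norm_inner_le_norm (𝕜 := ℂ) z v
    have e3 := hlow z hz
    rw [le_div_iff₀ hτ0]
    rcases (norm_nonneg (lin A' z)).eq_or_lt with h0 | h0
    · rw [← h0, zero_mul]; exact norm_nonneg _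
    · refine le_of_mul_le_mul_left ?_ h0
      nlinarith [mul_le_mul_of_nonneg_right e3 (norm_nonneg v)]
  set w := v - V.starProjection v with hw
  have hwV : w ∈ Vᗮ := V.sub_starProjection_mem_orthogonal v
  have hwker : w ∈ LinearMap.ker (lin A) := by
    rwa [hV, Submodule.orthogonal_orthogonal] at hwV
  have e1 : ‖w‖ * ‖w‖ = ‖inner ℂ (lin A' w) (lin A' z)‖ := by
    have : inner ℂ w w = inner ℂ w v := by
      conv_lhs => rw [hw, inner_sub_right, ← hw]
      rw [Submodule.inner_left_of_mem_orthogonal (V.starProjection_apply_mem v) hwV, sub_zero]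
    rw [← LinearMap.adjoint_inner_right, hzv, ← this, inner_self_eq_norm_sq_to_K]; simp [sq]
  have e2 : ‖w‖ * ‖w‖ ≤ (δ * ‖w‖) * (‖v‖ / τ) := by
    rw [e1]
    exact (norm_inner_le_norm _ _).trans
      (mul_le_mul (norm_lin_le_of_mem_ker hwker) hy (norm_nonneg _) (by positivity))
  rcases (norm_nonneg w).eq_or_lt with h0 | h0
  · rw [← h0]; positivity
  · refine le_of_mul_le_mul_left (e2.trans_eq ?_) h0
    ring

end Gap

/-! ### Backward and forward errors -/

section Errors

variable {m n : ℕ} {A A' : Mat m n} {β : ℝ}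

theorem norm_sub_thetaProj_le (hA : A ≠ 0) (h1 : ‖A - A'‖ ≤ β)
    (h2 : β < ‖pinv A‖⁻¹ - ‖A - A'‖) : ‖A' - thetaProj β A'‖ ≤ ‖A - A'‖ := by
  refine norm_le_of_norm_lin_le _ (norm_nonneg _) fun x => ?_
  rw [lin_sub_apply, lin_thetaProj, ← map_sub]
  have e1 := norm_lin_le_mul β A' (norm_nonneg _) (sv_le_of_not_lt_sv hA h1 h2)
    ((rightSpace β A').sub_starProjection_mem_orthogonal x)
  refine e1.trans (mul_le_mul_of_nonneg_left ?_ (norm_nonneg _))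
  simpa using norm_sub_starProjection_le_norm_sub (rightSpace β A') x (Submodule.zero_mem _)

theorem rank_thetaProj (hA : A ≠ 0) (h1 : ‖A - A'‖ ≤ β) (h2 : β < ‖pinv A‖⁻¹ - ‖A - A'‖) :
    (thetaProj β A').rank = A.rank := by
  rw [← finrank_orthogonal_ker_lin, ker_lin_thetaProj β A' ((norm_nonneg _).trans h1),
    Submodule.orthogonal_orthogonal, ← finrank_orthogonal_ker_eq_finrank_rightSpace hA h1 h2,
    finrank_orthogonal_ker_lin]

theorem vecProj_mem_range (θ : ℝ) (G : Mat m n) (d : Vec m) :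
    vecProj θ G d ∈ LinearMap.range (lin (thetaProj θ G)) :=
  Submodule.starProjection_apply_mem _ _

/-- The components of `x` in `rightSpace θ G` and in its orthogonal complement have orthogonal images
under `G`, so projecting `G x` to the range of the `θ`-projection keeps just the former. -/
theorem vecProj_lin (θ : ℝ) (G : Mat m n) (x : Vec n) :
    vecProj θ G (lin G x) = lin (thetaProj θ G) x := by
  refine Submodule.eq_starProjection_of_mem_of_inner_eq_zero ⟨x, rfl⟩ ?_
  rintro _ ⟨y, rfl⟩
  rw [lin_thetaProj, lin_thetaProj, ← map_sub]
  exact inner_lin_lin_eq_zero θ G (Submodule.starProjection_apply_mem _ _)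
    (Submodule.sub_starProjection_mem_orthogonal _)

theorem norm_sub_vecProj_le (hA : A ≠ 0) (h1 : ‖A - A'‖ ≤ β)
    (h2 : β < ‖pinv A‖⁻¹ - ‖A - A'‖) (x : Vec n) (b' : Vec m) :
    ‖b' - vecProj β A' b'‖ ≤ ‖b' - lin A x‖ + 2 * ‖A - A'‖ * ‖x‖ := by
  have e1 := norm_sub_starProjection_le_norm_sub (LinearMap.range (lin (thetaProj β A'))) b'
    (w := lin (thetaProj β A') x) ⟨x, rfl⟩
  refine e1.trans ?_
  have e2 : b' - lin (thetaProj β A') x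
      = (b' - lin A x) + (lin (A - A') x + lin (A' - thetaProj β A') x) := by
    rw [lin_sub_apply, lin_sub_apply]; abel
  rw [e2]
  have e3 := norm_lin_le (A - A') x
  have e4 := (norm_lin_le (A' - thetaProj β A') x).trans
    (mul_le_mul_of_nonneg_right (norm_sub_thetaProj_le hA h1 h2) (norm_nonneg x))
  have e5 := norm_add_le (b' - lin A x) (lin (A - A') x + lin (A' - thetaProj β A') x)
  have e6 := norm_add_le (lin (A - A') x) (lin (A' - thetaProj β A') x)
  linarith

/-- The perturbed solution `x'` of minimal norm and the projection `p` of `x` both lie in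
`rightSpace β A'`, where `A'` is bounded below, and `A' (x' - p)` is the projection of `b' - A' x`
to the range of the `β`-projection of `A'`. -/
theorem norm_minNormPoint_sub_starProjection_le (hA : A ≠ 0) (h1 : ‖A - A'‖ ≤ β)
    (h2 : β < ‖pinv A‖⁻¹ - ‖A - A'‖) (x : Vec n) (b' : Vec m) :
    ‖minNormPoint (sol (thetaProj β A') (vecProj β A' b')) - (rightSpace β A').starProjection x‖
      ≤ (‖b' - lin A x‖ + ‖A - A'‖ * ‖x‖) / (‖pinv A‖⁻¹ - ‖A - A'‖) := by
  have hβ : 0 ≤ β := (norm_nonneg _).trans h1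
  have hτ0 : 0 < ‖pinv A‖⁻¹ - ‖A - A'‖ := hβ.trans_lt h2
  obtain ⟨z, hz⟩ := vecProj_mem_range β A' b'
  set x' := (rightSpace β A').starProjection z with hx'
  have hx'V : x' ∈ rightSpace β A' := Submodule.starProjection_apply_mem _ _
  have hBx' : lin (thetaProj β A') x' = vecProj β A' b' := by
    rw [← hz, lin_thetaProj, lin_thetaProj, Submodule.starProjection_eq_self_iff.2 hx'V]
  rw [← hBx', minNormPoint_sol_eq (by
    rwa [ker_lin_thetaProj β A' hβ, Submodule.orthogonal_orthogonal])]
  have e1 := mul_norm_le_norm_lin β A' hτ0.le (le_sv_of_lt_sv hA h1)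
    (Submodule.sub_mem _ hx'V ((rightSpace β A').starProjection_apply_mem x))
  have e2 : lin A' (x' - (rightSpace β A').starProjection x)
      = vecProj β A' ((b' - lin A x) + lin (A - A') x) := by
    rw [map_sub, hx', ← lin_thetaProj, ← lin_thetaProj, hz, ← vecProj_lin, lin_sub_apply,
      sub_add_sub_cancel, vecProj, vecProj, vecProj, map_sub]
  rw [le_div_iff₀ hτ0, mul_comm]
  refine e1.trans ?_
  rw [e2]
  refine (Submodule.norm_starProjection_apply_le _ _).trans ((norm_add_le _ _).trans ?_)
  gcongr
  exact norm_lin_le _ _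

theorem affineDist_sol_le (hA : A ≠ 0) (h0 : ‖A - A'‖ < 1 / 2 * ‖pinv A‖⁻¹)
    (h1 : ‖A - A'‖ ≤ β) (h2 : β < ‖pinv A‖⁻¹ - ‖A - A'‖) {x : Vec n}
    (hx : x ∈ (LinearMap.ker (lin A))ᗮ) (b' : Vec m) :
    affineDist (sol (thetaProj β A') (vecProj β A' b')) (sol A (lin A x))
      ≤ √(4 * ‖x‖ ^ 2 + 1) / (‖pinv A‖⁻¹ - ‖A - A'‖) * pairNorm (A' - A) (b' - lin A x) := by
  have hβ : 0 ≤ β := (norm_nonneg _).trans h1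
  have hτ0 : 0 < ‖pinv A‖⁻¹ - ‖A - A'‖ := hβ.trans_lt h2
  have hrank := finrank_orthogonal_ker_eq_finrank_rightSpace hA h1 h2
  have hc0 : 0 ≤ ‖A - A'‖ / (‖pinv A‖⁻¹ - ‖A - A'‖) := by positivity
  have hc1 : ‖A - A'‖ / (‖pinv A‖⁻¹ - ‖A - A'‖) < 1 := by
    rw [div_lt_one hτ0]; linarith
  have hgap := fun v (hv : v ∈ rightSpace β A') =>
    norm_sub_starProjection_le_of_mem_rightSpace hA h1 h2 hv
  rw [div_mul_eq_mul_div, le_div_iff₀ hτ0, pairNorm, ← Real.sqrt_mul (by positivity),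
    norm_sub_rev A' A]
  refine Real.le_sqrt_of_sq_le ?_
  set δ := ‖A - A'‖
  set ε := ‖b' - lin A x‖
  set τ := ‖pinv A‖⁻¹ - δ
  have hδ0 : 0 ≤ δ := norm_nonneg _
  have hε0 : 0 ≤ ε := norm_nonneg _
  have key : affineDist (sol (thetaProj β A') (vecProj β A' b')) (sol A (lin A x)) * τ
      ≤ max (2 * ‖x‖ * δ + ε) δ := by
    rw [affineDist, max_mul_of_nonneg _ _ hτ0.le]
    refine max_le_max ?_ ?_
    · rw [minNormPoint_sol_eq hx]
      have e1 := norm_minNormPoint_sub_starProjection_le hA h1 h2 x b'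
      have e2 := norm_sub_starProjection_le_symm hrank hc0 hc1 hgap hx
      rw [le_div_iff₀ hτ0] at e1
      rw [div_mul_eq_mul_div, le_div_iff₀ hτ0] at e2
      have e3 := norm_sub_le_norm_sub_add_norm_sub
        (minNormPoint (sol (thetaProj β A') (vecProj β A' b')))
        ((rightSpace β A').starProjection x) x
      rw [norm_sub_rev ((rightSpace β A').starProjection x) x] at e3
      have e4 := mul_le_mul_of_nonneg_right e3 hτ0.le
      rw [add_mul] at e4
      linarith
    · rw [subspaceDist, direction_sol (vecProj_mem_range β A' b'), direction_sol ⟨x, rfl⟩,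
        ker_lin_thetaProj β A' hβ]
      have e1 := norm_starProjection_sub_starProjection_le hrank hc0 hc1 hgap
      -- Passing to orthogonal complements only changes the sign of the difference.
      have e2 : (rightSpace β A')ᗮ.starProjection - (LinearMap.ker (lin A)).starProjection
          = -((rightSpace β A').starProjection - (LinearMap.ker (lin A))ᗮ.starProjection) := by
        ext1 y
        simp only [sub_apply, neg_apply, Submodule.starProjection_orthogonal_val]
        abel
      rw [e2, norm_neg, ← le_div_iff₀ hτ0]
      exact e1
  have hnn : 0 ≤ affineDist (sol (thetaProj β A') (vecProj β A' b')) (sol A (lin A x)) * τ :=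
    mul_nonneg (le_max_of_le_left (norm_nonneg _)) hτ0.le
  refine (pow_le_pow_left₀ hnn key 2).trans ?_
  rcases max_cases (2 * ‖x‖ * δ + ε) δ with ⟨h, _⟩ | ⟨h, _⟩ <;> rw [h]
  -- The Cauchy-Schwarz inequality for the vectors `(2‖x‖, 1)` and `(δ, ε)`.
  · nlinarith [sq_nonneg (2 * ‖x‖ * ε - δ)]
  · nlinarith [mul_nonneg (sq_nonneg ‖x‖) (sq_nonneg δ), mul_nonneg (sq_nonneg ‖x‖) (sq_nonneg ε),
      sq_nonneg ε]

theorem norm_le_pairNorm_left (M : Mat m n) (d : Vec m) : ‖M‖ ≤ pairNorm M d :=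
  Real.le_sqrt_of_sq_le (by nlinarith [sq_nonneg ‖d‖])

theorem norm_le_pairNorm_right (M : Mat m n) (d : Vec m) : ‖d‖ ≤ pairNorm M d :=
  Real.le_sqrt_of_sq_le (by nlinarith [sq_nonneg ‖M‖])

theorem pairNorm_le_add (M : Mat m n) (d : Vec m) : pairNorm M d ≤ ‖M‖ + ‖d‖ :=
  Real.sqrt_le_iff.2 ⟨by positivity, by nlinarith [mul_nonneg (norm_nonneg M) (norm_nonneg d)]⟩

end Errors

end NumLinSys

theorem corollary3 {m n : ℕ} (A : Mat m n) (hA : A ≠ 0) (b : Vec m)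
    (hb : b ∈ LinearMap.range (lin A)) :
    ∃ C : ℝ, ∀ (A' : Mat m n) (b' : Vec m) (β : ℝ),
      ‖A - A'‖ < 1 / 2 * ‖pinv A‖⁻¹ →
      ‖A - A'‖ < β →
      β < ‖pinv A‖⁻¹ - ‖A - A'‖ →
      -- the projection of `A'` within the tolerance `β` is well defined
      (∀ j : ℕ, sv A' j ≠ β) ∧
      -- both solutions lie in the same affine Grassmannian
      sol A b ∈ affineGrassmannian (n - A.rank) n ∧
      sol (thetaProj β A') (vecProj β A' b') ∈ affineGrassmannian (n - A.rank) n ∧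
      -- the backward error is of the order of the data error
      pairNorm (A' - thetaProj β A') (b' - vecProj β A' b') ≤ C * pairNorm (A' - A) (b' - b) ∧
      -- the forward error is of the order of the data error
      affineDist (sol (thetaProj β A') (vecProj β A' b')) (sol A b)
        ≤ C * pairNorm (A' - A) (b' - b) ∧
      -- the explicit forward error bound
      affineDist (sol (thetaProj β A') (vecProj β A' b')) (sol A b)
        ≤ ‖A‖ * ‖pinv A‖ *
            (√(4 * ‖lin (pinv A) b‖ ^ 2 + 1) / (‖A‖ - ‖A‖ * ‖pinv A‖ * ‖A - A'‖)) *
          pairNorm (A' - A) (b' - b) := by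
  set x := lin (pinv A) b with hx
  have hxV : x ∈ (LinearMap.ker (lin A))ᗮ := lin_pinv_mem_orthogonal_ker A b
  have hxb : lin A x = b := lin_lin_pinv_of_mem_range A hb
  have hA0 : 0 < ‖A‖ := norm_pos_iff.2 hA
  have hp0 : 0 < ‖pinv A‖ := norm_pinv_pos A hA
  -- The first entry serves the backward error, and the second one the forward error, where
  -- `‖A - A'‖ < ‖A†‖⁻¹ / 2` bounds `(‖A†‖⁻¹ - ‖A - A'‖)⁻¹` by `2 ‖A†‖`.
  refine ⟨max (2 + 2 * ‖x‖) (√(4 * ‖x‖ ^ 2 + 1) * (2 * ‖pinv A‖)), fun A' b' β h0 h1 h2 => ?_⟩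
  have hd0 : 0 ≤ pairNorm (A' - A) (b' - b) := Real.sqrt_nonneg _
  have hτ : 1 / 2 * ‖pinv A‖⁻¹ < ‖pinv A‖⁻¹ - ‖A - A'‖ := by linarith
  have hτ0 : 0 < ‖pinv A‖⁻¹ - ‖A - A'‖ := lt_trans (by positivity) hτ
  have hfwd := affineDist_sol_le hA h0 h1.le h2 hxV b'
  rw [hxb] at hfwd
  refine ⟨sv_ne hA h1 h2, sol_mem_affineGrassmannian hb, ?_, ?_, ?_, ?_⟩
  · rw [← rank_thetaProj hA h1.le h2]
    exact sol_mem_affineGrassmannian (vecProj_mem_range β A' b')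
  · have e1 := norm_sub_thetaProj_le hA h1.le h2
    have e2 := norm_sub_vecProj_le hA h1.le h2 x b'
    rw [hxb] at e2
    have e3 := norm_le_pairNorm_left (A' - A) (b' - b)
    rw [norm_sub_rev] at e3
    have e4 := norm_le_pairNorm_right (A' - A) (b' - b)
    have e5 := mul_le_mul_of_nonneg_right e3 (norm_nonneg x)
    refine (pairNorm_le_add _ _).trans (le_trans ?_
      (mul_le_mul_of_nonneg_right (le_max_left _ _) hd0))
    linarith
  · refine hfwd.trans (mul_le_mul_of_nonneg_right (le_trans ?_ (le_max_right _ _)) hd0)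
    rw [div_eq_mul_inv]
    refine mul_le_mul_of_nonneg_left ?_ (Real.sqrt_nonneg _)
    rw [inv_le_comm₀ hτ0 (by positivity), mul_inv, ← one_div]
    exact hτ.le
  · refine hfwd.trans_eq ?_
    have e1 : ‖A‖ - ‖A‖ * ‖pinv A‖ * ‖A - A'‖
        = ‖A‖ * ‖pinv A‖ * (‖pinv A‖⁻¹ - ‖A - A'‖) := by
      field_simp
    rw [e1, ← mul_div_assoc, mul_div_mul_left _ _ (by positivity)]
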